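/- Let $G$ be a topological group, and write $G_r$ for $G$ with its right uniformity. A set $\mathcal U$ of subsets of $G$ is a uniform covering of $G_r$ if there is a neighbourhood $W$ of the identity such that for every $x\in G$ the set $Wx$ is contained in a member of $\mathcal U$. Let $\mathcal F(G)$ be the set of all finite subsets of $G$ and $\mathcal N(G_r)$ the set of all finite uniform coverings of $G_r$. For sets $\mathcal U,\mathcal V$ of subsets of $G$, write $\mathcal U\preceq\mathcal V$ ($\mathcal V$ refines $\mathcal U$) if every $V\in\mathcal V$ is contained in some $U\in\mathcal U$. For $\mathcal U\in\mathcal N(G_r)$ put $$N(\mathcal U)=\min\{|\mathcal V| : \mathcal V\in\mathcal N(G_r),\ \mathcal U\preceq\mathcal V\}.$$ For $g\in G$ let $g(\mathcal V)=\{gV : V\in\mathcal V\}$, and for $E\in\mathcal F(G)$ let $$\bigvee_{g\in E} g(\mathcal V)=\Bigl\{\bigcap_{g\in E} gV_g : V_g\in\mathcal V \text{ for each } g\in E\Bigr\},$$ where the empty intersection is $G$. Let $UC_b(G_r)$ be the space of all bounded real-valued functions on $G$ that are uniformly continuous with respect to the right uniformity. The group $G$ is called amenable if there is a linear map $m\colon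 UC_b(G_r)\to\mathbb R$ such that $\inf_{x\in G} f(x)\le m(f)\le\sup_{x\in G} f(x)$ and $m(x\mapsto f(gx))=m(f)$ for all $f\in UC_b(G_r)$ and $g\in G$. Corollary 7.3. Let $G$ be a non-discrete Hausdorff topological group. Then $G$ is amenable if and only if $$\sup_{E\in\mathcal F(G)}\ \sup_{\mathcal U\in\mathcal N(G_r)}\ \inf\left\{\frac{N\bigl(\bigvee_{g\in E} g(\mathcal V)\bigr)}{N(\mathcal V)} : \mathcal V\in\mathcal N(G_r),\ \mathcal U\preceq\mathcal V\right\}=1.$$ -/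

import Mathlib

open scoped Topology Uniformity ENNReal

namespace UniformCover

/-- `𝒱` refines `𝒰`: every member of `𝒱` is contained in some member of `𝒰`. -/
def Refines {X : Type*} (𝒱 𝒰 : Set (Set X)) : Prop :=
  ∀ V ∈ 𝒱, ∃ U ∈ 𝒰, V ⊆ U

/-- The join `⋁ i, 𝒰 i` of a family of set systems: all intersections `⋂ i, U i` of
selections with `U i ∈ 𝒰 i`. -/
def join {ι X : Type*} (𝒰 : ι → Set (Set X)) : Set (Set X) :=
  {S | ∃ U : ι → Set X, (∀ i, U i ∈ 𝒰 i) ∧ S = ⋂ i, U i}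

/-- The image `f(𝒰) = {f(U) | U ∈ 𝒰}` of a set system under a map. -/
def image {X Y : Type*} (f : X → Y) (𝒰 : Set (Set X)) : Set (Set Y) :=
  {S | ∃ U ∈ 𝒰, S = f '' U}

/-- A uniform covering of a uniform space: there is an entourage `D` such that every
`D`-ball `{y | (x, y) ∈ D}` is contained in a member of `𝒰`. -/
def IsUniformCover {X : Type*} [UniformSpace X] (𝒰 : Set (Set X)) : Prop :=
  ∃ D ∈ 𝓤 X, ∀ x : X, ∃ U ∈ 𝒰, {y | (x, y) ∈ D} ⊆ U

/-- The set of all finite uniform coverings of the uniform space `X`. -/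
def finiteUniformCovers (X : Type*) [UniformSpace X] : Set (Set (Set X)) :=
  {𝒰 | 𝒰.Finite ∧ IsUniformCover 𝒰}

/-- The uniform complexity `N(𝒰)`: the least cardinality of a finite uniform covering
refining `𝒰`. (It is meant for finite uniform coverings `𝒰`, where the set of
cardinalities contains that of `𝒰` itself.) -/
noncomputable def uniformComplexity {X : Type*} [UniformSpace X] (𝒰 : Set (Set X)) : ℕ :=
  sInf {n | ∃ 𝒱 ∈ finiteUniformCovers X, Refines 𝒱 𝒰 ∧ 𝒱.ncard = n}

/-- For the right uniformity of a topological group, the uniform coverings are the set systems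
that are refined by `{W x | x ∈ G}` for some neighbourhood `W` of `1`. -/
theorem isUniformCover_right_iff {G : Type*} [Group G] [TopologicalSpace G]
    [IsTopologicalGroup G] (𝒰 : Set (Set G)) :
    @IsUniformCover G (IsTopologicalGroup.rightUniformSpace G) 𝒰 ↔
      ∃ W ∈ 𝓝 (1 : G), Refines {S | ∃ x : G, S = (fun w => w * x) '' W} 𝒰 := by
  let : UniformSpace G := IsTopologicalGroup.rightUniformSpace G
  constructor
  · rintro ⟨D, hD, h⟩
    obtain ⟨W, hW, hWD⟩ := hD
    refine ⟨W, hW, ?_⟩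
    rintro _ ⟨x, rfl⟩
    obtain ⟨U, hU, hxU⟩ := h x
    refine ⟨U, hU, ?_⟩
    rintro _ ⟨w, hw, rfl⟩
    exact hxU (hWD (by simpa using hw))
  · rintro ⟨W, hW, h⟩
    refine ⟨_, ⟨W, hW, subset_rfl⟩, fun x => ?_⟩
    obtain ⟨U, hU, hxU⟩ := h _ ⟨x, rfl⟩
    exact ⟨U, hU, fun y hy => hxU ⟨y * x⁻¹, hy, by simp⟩⟩

end UniformCover

/-- `UC_b(X)`: the space of bounded uniformly continuous real-valued functions on `X`. -/
def boundedUniformlyContinuous (X : Type*) [UniformSpace X] : Submodule ℝ (X → ℝ) where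
  carrier := {f | UniformContinuous f ∧ ∃ C : ℝ, ∀ x, |f x| ≤ C}
  zero_mem' := ⟨uniformContinuous_const, 0, fun x => by simp⟩
  add_mem' := by
    rintro f g ⟨hf, C, hC⟩ ⟨hg, D, hD⟩
    exact ⟨hf.add hg, C + D, fun x => (abs_add_le _ _).trans (add_le_add (hC x) (hD x))⟩
  smul_mem' := by
    rintro c f ⟨hf, C, hC⟩
    refine ⟨hf.const_smul c, |c| * C, fun x => ?_⟩
    simpa [abs_mul] using mul_le_mul_of_nonneg_left (hC x) (abs_nonneg c)

/-- A mean on a linear space `H` of bounded real-valued functions on `X`. -/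
def IsMean {X : Type*} (H : Submodule ℝ (X → ℝ)) (m : H →ₗ[ℝ] ℝ) : Prop :=
  ∀ f : H, (⨅ x, (f : X → ℝ) x) ≤ m f ∧ m f ≤ ⨆ x, (f : X → ℝ) x

/-- `UC_b(G_r)`: bounded functions that are uniformly continuous for the right uniformity. -/
def rightUCb (G : Type*) [Group G] [TopologicalSpace G] [IsTopologicalGroup G] :
    Submodule ℝ (G → ℝ) :=
  @boundedUniformlyContinuous G (IsTopologicalGroup.rightUniformSpace G)

/-- Left translations are uniformly continuous for the right uniformity. -/
theorem uniformContinuous_leftTranslation_right {G : Type*} [Group G] [TopologicalSpace G]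
    [IsTopologicalGroup G] (g : G) :
    @UniformContinuous G G (IsTopologicalGroup.rightUniformSpace G)
      (IsTopologicalGroup.rightUniformSpace G) (fun x => g * x) := by
  let : UniformSpace G := IsTopologicalGroup.rightUniformSpace G
  have h : Filter.Tendsto (fun z : G => g * z * g⁻¹) (𝓝 1) (𝓝 1) := by
    have : Continuous (fun z : G => g * z * g⁻¹) := by fun_prop
    simpa using this.tendsto 1
  refine Filter.tendsto_comap_iff.2 ((h.comp Filter.tendsto_comap).congr fun p => ?_)
  simp [mul_assoc]

/-- The function `f ∘ λ(g) : x ↦ f (g x)`, for `f ∈ UC_b(G_r)`. -/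
def rightUCb.translate {G : Type*} [Group G] [TopologicalSpace G] [IsTopologicalGroup G]
    (g : G) (f : rightUCb G) : rightUCb G :=
  ⟨fun x => (f : G → ℝ) (g * x),
    by
      let : UniformSpace G := IsTopologicalGroup.rightUniformSpace G
      exact f.2.1.comp (uniformContinuous_leftTranslation_right g),
    f.2.2.imp fun _ hC x => hC (g * x)⟩

/-- A topological group `G` is amenable if there is a mean on `UC_b(G_r)` that is invariant
under all left translations. -/
def IsAmenableTopologicalGroup (G : Type*) [Group G] [TopologicalSpace G]
    [IsTopologicalGroup G] : Prop :=
  ∃ m : rightUCb G →ₗ[ℝ] ℝ, IsMean (rightUCb G) m ∧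
    ∀ (g : G) (f : rightUCb G), m (rightUCb.translate g f) = m f

/-- The finite uniform coverings of `G_r`, i.e. of `G` with its right uniformity. -/
def rightFiniteUniformCovers (G : Type*) [Group G] [TopologicalSpace G]
    [IsTopologicalGroup G] : Set (Set (Set G)) :=
  @UniformCover.finiteUniformCovers G (IsTopologicalGroup.rightUniformSpace G)

/-- The uniform complexity of a finite uniform covering of `G_r`. -/
noncomputable def rightUniformComplexity {G : Type*} [Group G] [TopologicalSpace G]
    [IsTopologicalGroup G] (𝒰 : Set (Set G)) : ℕ :=
  @UniformCover.uniformComplexity G (IsTopologicalGroup.rightUniformSpace G) 𝒰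

/-- The join `⋁_{g ∈ E} g(𝒱)` of the left translates of `𝒱` by the elements of `E`. -/
def translateJoin {G : Type*} [Group G] (E : Finset G) (𝒱 : Set (Set G)) : Set (Set G) :=
  UniformCover.join (fun g : E => UniformCover.image (fun x : G => (g : G) * x) 𝒱)

/-! Both conditions are linked to a matching property: for every uniformly continuous map `u` from
`G_r` to a compact space, there are points `x i` that each `g ∈ E` permutes, up to a small error in
`u` and a small proportion of exceptions (`IsAlmostPermuted`). Hall's theorem with deficiency
produces the matchings on both sides.

If joins of translates cost little, pick a point in each nonempty member of a minimal refinement of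
the join. A Hall violator would yield a covering refining `𝒱` with fewer than `N(𝒱)` members, so the
deficiency is at most the excess over `N(𝒱)` (`exists_isAlmostPermuted_of_complexity`). Averages
over such points are almost invariant, and an ultrafilter limit of them is an invariant mean.

Conversely, Hahn–Banach turns an invariant mean into almost invariant averages over points, and a
partition of unity with Hall's theorem turns these into matchings. Since `G` is not discrete, the
points can be moved so that their translates are distinct. A refinement `𝒱` of `𝒰` is then built in
which each point is private to one member, so `N(𝒱) ≥ n`, while matched translates share one member
of the join. Hence the join costs at most `n`, plus one member per exception, plus a constant
independent of `n` (`exists_cover_of_labelling`). -/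

open Filter Set

/-! ### Functions on uniform spaces -/

/-- Every entourage contains an entourage of a coarser pseudometric. -/
theorem exists_pseudoMetricSpace_of_mem_uniformity {X : Type*} [UniformSpace X]
    {D : Set (X × X)} (hD : D ∈ 𝓤 X) :
    ∃ d : PseudoMetricSpace X, (∀ ε > 0, {p : X × X | d.dist p.1 p.2 < ε} ∈ 𝓤 X) ∧
      ∃ ε > 0, {p : X × X | d.dist p.1 p.2 < ε} ⊆ D := by
  choose! next hnext hsymm hcomp using fun s (hs : s ∈ 𝓤 X) => comp_symm_of_uniformity hs
  -- Symmetric entourages, each composed with itself inside the preceding one. They generate a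
  -- coarser, countably generated uniformity, which is therefore pseudometrizable.
  let E : ℕ → Set (X × X) := fun n => Nat.rec (next D) (fun _ s => next s) n
  have hE : ∀ n, E n ∈ 𝓤 X := fun n => by
    induction n with
    | zero => exact hnext D hD
    | succ n ih => exact hnext _ ih
  have hEs : ∀ n {a b}, (a, b) ∈ E n → (b, a) ∈ E n := fun n => by
    cases n with
    | zero => exact fun h => hsymm D hD h
    | succ n => exact fun h => hsymm _ (hE n) h
  have hrefl : ∀ n x, (x, x) ∈ E n := fun n x => refl_mem_uniformity (hE n)
  have hEc : ∀ n {a b c}, (a, b) ∈ E (n + 1) → (b, c) ∈ E (n + 1) → (a, c) ∈ E n :=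
    fun n a b c h h' => hcomp _ (hE n) ⟨b, h, h'⟩
  have hanti : Antitone E := antitone_nat_of_succ_le fun n p hp => hEc n hp (hrefl (n + 1) p.2)
  have hED : E 0 ⊆ D := fun p hp => hcomp D hD ⟨p.2, hp, hrefl 0 _⟩
  let B : FilterBasis (X × X) :=
    { sets := range E
      nonempty := range_nonempty E
      inter_sets := by
        rintro _ _ ⟨m, rfl⟩ ⟨n, rfl⟩
        exact ⟨E (max m n), ⟨_, rfl⟩,
          subset_inter (hanti (le_max_left m n)) (hanti (le_max_right m n))⟩ }
  let C : UniformSpace.Core X := UniformSpace.Core.mkOfBasis B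
    (by rintro _ ⟨n, rfl⟩ x; exact hrefl n x)
    (by rintro _ ⟨n, rfl⟩; exact ⟨E n, ⟨n, rfl⟩, fun p hp => hEs n hp⟩)
    (by
      rintro _ ⟨n, rfl⟩
      refine ⟨E (n + 1), ⟨n + 1, rfl⟩, ?_⟩
      rintro ⟨a, c⟩ ⟨b, h, h'⟩
      exact hEc n h h')
  let V : UniformSpace X := UniformSpace.ofCore C
  have hV : 𝓤[V] = B.filter := rfl
  have hb : (𝓤[V]).HasBasis (fun _ : ℕ => True) E := by
    rw [hV]
    exact B.hasBasis.to_hasBasis (by rintro _ ⟨n, rfl⟩; exact ⟨n, trivial, subset_rfl⟩)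
      fun n _ => ⟨E n, ⟨n, rfl⟩, subset_rfl⟩
  have : IsCountablyGenerated 𝓤[V] := hb.isCountablyGenerated
  let d : PseudoMetricSpace X := @UniformSpace.pseudoMetricSpace X V this
  have hd : 𝓤[d.toUniformSpace] = 𝓤[V] := rfl
  refine ⟨d, fun ε hε => ?_, ?_⟩
  · have : {p : X × X | d.dist p.1 p.2 < ε} ∈ 𝓤[V] := hd ▸ Metric.dist_mem_uniformity hε
    obtain ⟨n, -, hn⟩ := hb.mem_iff.1 this
    exact mem_of_superset (hE n) hn
  · have : E 0 ∈ 𝓤[d.toUniformSpace] := hd ▸ hb.mem_of_mem (i := 0) trivial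
    obtain ⟨ε, hε, h⟩ := Metric.mem_uniformity_dist.1 this
    exact ⟨ε, hε, fun p hp => hED (h hp)⟩

/-- Urysohn's lemma for uniform spaces. -/
theorem exists_uniformContinuous_one_on {X : Type*} [UniformSpace X]
    {D : Set (X × X)} (hD : D ∈ 𝓤 X) (A : Set X) :
    ∃ u : X → unitInterval, UniformContinuous u ∧ (∀ x ∈ A, u x = 1) ∧
      ∀ x, u x ≠ 0 → ∃ a ∈ A, (a, x) ∈ D := by
  obtain ⟨d, hd, ε, hε, hεD⟩ := exists_pseudoMetricSpace_of_mem_uniformity hD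
  let f := @thickenedIndicator X d.toPseudoEMetricSpace ε hε A
  have hf1 : ∀ x, f x ≤ 1 := @thickenedIndicator_le_one X d.toPseudoEMetricSpace ε hε A
  have huc : UniformContinuous (fun x => (f x : ℝ)) := by
    have h := (@lipschitzWith_thickenedIndicator X d.toPseudoEMetricSpace ε hε A).uniformContinuous
    have h2 : @UniformContinuous X NNReal _ _ f := by
      intro s hs
      obtain ⟨η, hη, h'⟩ := (@Metric.mem_uniformity_dist X d _).1 (h hs)
      exact Filter.mem_map.2 (mem_of_superset (hd η hη) fun p hp => h' (a := p.1) (b := p.2) hp)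
    exact uniformContinuous_subtype_val.comp h2
  refine ⟨fun x => ⟨f x, (f x).2, by exact_mod_cast hf1 x⟩, huc.subtype_mk _, fun x hx => ?_,
    fun x hx => ?_⟩
  · have := @thickenedIndicator_one X d.toPseudoEMetricSpace ε hε A x hx
    exact Subtype.ext (by simp [f, this])
  · by_contra! hcon
    refine hx (Subtype.ext ?_)
    have := @thickenedIndicator_zero X d.toPseudoEMetricSpace ε hε A x (by
      intro hmem
      obtain ⟨a, ha, hxa⟩ := (@Metric.mem_thickening_iff ε X d _ _).1 hmem
      exact hcon a ha (hεD (show d.dist a x < ε by rw [d.dist_comm]; exact hxa)))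
    simp [f, this]

/-- Urysohn's lemma is applied to the core of `U`, the points whose `D`-ball lies in `U`: the cores
cover the space, and the `D`-neighbourhood of a core stays inside `U`. -/
theorem UniformCover.IsUniformCover.exists_uniformContinuous {X : Type*} [UniformSpace X]
    {𝒰 : Set (Set X)} (h𝒰 : UniformCover.IsUniformCover 𝒰) :
    ∃ u : 𝒰 → X → unitInterval, (∀ U, UniformContinuous (u U)) ∧ (∀ x, ∃ U, u U x = 1) ∧
      ∀ U x, u U x ≠ 0 → x ∈ (U : Set X) := by
  obtain ⟨D, hD, h⟩ := h𝒰
  choose u hu hu1 hu0 using fun U : 𝒰 =>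
    exists_uniformContinuous_one_on hD {x | {y | (x, y) ∈ D} ⊆ (U : Set X)}
  refine ⟨u, hu, fun x => ?_, fun U x hx => ?_⟩
  · obtain ⟨U, hU, hx⟩ := h x
    exact ⟨⟨U, hU⟩, hu1 _ x hx⟩
  · obtain ⟨a, ha, hax⟩ := hu0 U x hx
    exact ha hax

/-- A uniformly continuous map into a compact space has small oscillation on the members of some
finite uniform covering. -/
theorem UniformCover.exists_finiteUniformCovers_dist_lt {X K : Type*} [UniformSpace X]
    [PseudoMetricSpace K] [CompactSpace K] {u : X → K} (hu : UniformContinuous u) {ε : ℝ}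
    (hε : 0 < ε) :
    ∃ 𝒰 ∈ UniformCover.finiteUniformCovers X,
      ∀ U ∈ 𝒰, ∀ x ∈ U, ∀ y ∈ U, dist (u x) (u y) < ε := by
  obtain ⟨t, ht, htc⟩ := Metric.totallyBounded_iff.1 (isCompact_univ (X := K)).totallyBounded
    (ε / 4) (by positivity)
  refine ⟨(fun c => u ⁻¹' Metric.ball c (ε / 2)) '' t,
    ⟨ht.image _, _, hu (Metric.dist_mem_uniformity (show 0 < ε / 4 by positivity)), fun x => ?_⟩,
    ?_⟩
  · obtain ⟨c, hc, hxc⟩ := mem_iUnion₂.1 (htc (mem_univ (u x)))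
    refine ⟨_, ⟨c, hc, rfl⟩, fun y (hy : dist (u x) (u y) < ε / 4) => ?_⟩
    have := dist_triangle_left (u y) c (u x)
    rw [Metric.mem_ball] at hxc
    rw [mem_preimage, Metric.mem_ball]
    linarith
  · rintro _ ⟨c, -, rfl⟩ x hx y hy
    rw [mem_preimage, Metric.mem_ball] at hx hy
    linarith [dist_triangle_right (u x) (u y) c]

/-! ### Matchings with exceptions -/

/-- **Hall's theorem**, deficiency version. -/
theorem exists_injective_sum_of_card_le_biUnion_add {α β : Type*} [DecidableEq β]
    (r : α → Finset β) (d : ℕ) (h : ∀ S : Finset α, S.card ≤ (S.biUnion r).card + d) :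
    ∃ φ : α → β ⊕ Fin d, Function.Injective φ ∧ ∀ a b, φ a = Sum.inl b → b ∈ r a := by
  -- Ordinary Hall, after adding `d` dummy partners acceptable to everyone.
  obtain ⟨φ, hφ, hφr⟩ := (Finset.all_card_le_biUnion_card_iff_exists_injective
    (fun a => (r a).disjSum (Finset.univ : Finset (Fin d)))).1 fun S => by
      rcases S.eq_empty_or_nonempty with rfl | ⟨a, ha⟩
      · simp
      · have : (S.biUnion r).disjSum (Finset.univ : Finset (Fin d)) ⊆
            S.biUnion fun a => (r a).disjSum (Finset.univ : Finset (Fin d)) := by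
          rintro (b | t) hb
          · simpa using hb
          · simpa using ⟨a, ha⟩
        have := Finset.card_le_card this
        rw [Finset.card_disjSum, Finset.card_univ, Fintype.card_fin] at this
        exact (h S).trans this
  refine ⟨φ, hφ, fun a b hab => ?_⟩
  have := hφr a
  rw [hab] at this
  simpa using this

/-! ### Joins of translates and uniform complexity -/

theorem mem_translateJoin {G : Type*} [Group G] {E : Finset G} {𝒱 : Set (Set G)} {S : Set G} :
    S ∈ translateJoin E 𝒱 ↔
      ∃ V : E → Set G, (∀ g, V g ∈ 𝒱) ∧ S = {x | ∀ g : E, (g : G)⁻¹ * x ∈ V g} := by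
  have key : ∀ V : E → Set G,
      (⋂ g : E, (fun x : G => (g : G) * x) '' V g) = {x | ∀ g : E, (g : G)⁻¹ * x ∈ V g} := by
    intro V
    ext x
    simp [image_mul_left]
  constructor
  · rintro ⟨U, hU, rfl⟩
    choose V hV hUV using hU
    obtain rfl : U = fun g : E => (fun x : G => (g : G) * x) '' V g := funext hUV
    exact ⟨V, hV, key V⟩
  · rintro ⟨V, hV, rfl⟩
    exact ⟨_, fun g => ⟨V g, hV g, rfl⟩, (key V).symm⟩

section covers

variable {G : Type*} [Group G] [TopologicalSpace G] [IsTopologicalGroup G]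

theorem mem_rightFiniteUniformCovers_iff {𝒱 : Set (Set G)} :
    𝒱 ∈ rightFiniteUniformCovers G ↔
      𝒱.Finite ∧ ∃ W ∈ 𝓝 (1 : G), ∀ x, ∃ V ∈ 𝒱, ∀ w ∈ W, w * x ∈ V := by
  refine and_congr_right fun _ => (UniformCover.isUniformCover_right_iff 𝒱).trans ?_
  refine exists_congr fun W => and_congr_right fun _ => ⟨fun h x => ?_, ?_⟩
  · obtain ⟨V, hV, hx⟩ := h _ ⟨x, rfl⟩
    exact ⟨V, hV, fun w hw => hx ⟨w, hw, rfl⟩⟩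
  · rintro h _ ⟨x, rfl⟩
    obtain ⟨V, hV, hx⟩ := h x
    exact ⟨V, hV, image_subset_iff.2 hx⟩

/-- Since `g⁻¹ * (w * x) = (g⁻¹ * w * g) * (g⁻¹ * x)`, left translation acts on right-uniform
neighbourhoods by conjugation; this makes finitely many translates uniform at once. -/
theorem eventually_conj_mem (E : Finset G) {W : Set G} (hW : W ∈ 𝓝 (1 : G)) :
    ∃ W' ∈ 𝓝 (1 : G), ∀ g ∈ E, ∀ w ∈ W', g⁻¹ * w * g ∈ W := by
  refine ⟨⋂ g ∈ E, (fun w => g⁻¹ * w * g) ⁻¹' W, ?_, fun g hg w hw => mem_iInter₂.1 hw g hg⟩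
  refine (biInter_finset_mem E).2 fun g _ => ?_
  have : Continuous fun w => g⁻¹ * w * g := by fun_prop
  exact this.continuousAt.preimage_mem_nhds (by simpa using hW)

theorem rightUniformComplexity_le {𝒱 : Set (Set G)} {κ : Type*} [Fintype κ] (V : κ → Set G)
    (hV : ∀ k, ∃ U ∈ 𝒱, V k ⊆ U)
    (hu : ∃ W ∈ 𝓝 (1 : G), ∀ x, ∃ k, ∀ w ∈ W, w * x ∈ V k) :
    rightUniformComplexity 𝒱 ≤ Fintype.card κ := by
  obtain ⟨W, hW, h⟩ := hu
  have hmem : range V ∈ rightFiniteUniformCovers G :=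
    mem_rightFiniteUniformCovers_iff.2 ⟨finite_range V, W, hW, fun x =>
      let ⟨k, hk⟩ := h x
      ⟨V k, ⟨k, rfl⟩, hk⟩⟩
  have hle : rightUniformComplexity 𝒱 ≤ (range V).ncard :=
    Nat.sInf_le ⟨range V, hmem, by rintro _ ⟨k, rfl⟩; exact hV k, rfl⟩
  refine hle.trans ?_
  rw [← image_univ, ← Nat.card_eq_fintype_card, ← ncard_univ]
  exact ncard_image_le

theorem exists_refines_ncard_eq_rightUniformComplexity {𝒱 : Set (Set G)}
    (h𝒱 : 𝒱 ∈ rightFiniteUniformCovers G) :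
    ∃ 𝒲 ∈ rightFiniteUniformCovers G, UniformCover.Refines 𝒲 𝒱 ∧
      𝒲.ncard = rightUniformComplexity 𝒱 :=
  Nat.sInf_mem (s := {n | ∃ 𝒲 ∈ rightFiniteUniformCovers G, UniformCover.Refines 𝒲 𝒱 ∧
    𝒲.ncard = n}) ⟨_, 𝒱, h𝒱, fun V hV => ⟨V, hV, subset_rfl⟩, rfl⟩

theorem rightUniformComplexity_pos {𝒱 : Set (Set G)} (h𝒱 : 𝒱 ∈ rightFiniteUniformCovers G) :
    0 < rightUniformComplexity 𝒱 := by
  obtain ⟨𝒲, h𝒲, -, hcard⟩ := exists_refines_ncard_eq_rightUniformComplexity h𝒱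
  obtain ⟨hfin, W, -, h⟩ := mem_rightFiniteUniformCovers_iff.1 h𝒲
  obtain ⟨V, hV, -⟩ := h 1
  exact hcard ▸ (ncard_pos hfin).2 ⟨V, hV⟩

theorem translateJoin_mem_rightFiniteUniformCovers (E : Finset G) {𝒱 : Set (Set G)}
    (h𝒱 : 𝒱 ∈ rightFiniteUniformCovers G) :
    translateJoin E 𝒱 ∈ rightFiniteUniformCovers G := by
  obtain ⟨hfin, W, hW, h⟩ := mem_rightFiniteUniformCovers_iff.1 h𝒱
  refine mem_rightFiniteUniformCovers_iff.2 ⟨?_, ?_⟩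
  · refine ((Set.Finite.pi' fun _ : E => hfin).image
      fun V => {x | ∀ g : E, (g : G)⁻¹ * x ∈ V g}).subset fun S hS => ?_
    obtain ⟨V, hV, rfl⟩ := mem_translateJoin.1 hS
    exact ⟨V, hV, rfl⟩
  · obtain ⟨W', hW', hc⟩ := eventually_conj_mem E hW
    choose V hV hVW using h
    refine ⟨W', hW', fun x => ⟨_, mem_translateJoin.2
      ⟨fun g => V ((g : G)⁻¹ * x), fun g => hV _, rfl⟩, fun w hw g => ?_⟩⟩
    simpa [mul_assoc] using hVW ((g : G)⁻¹ * x) _ (hc g g.2 w hw)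

end covers

/-! ### From complexity to almost permuted points -/

/-- The points `x i` are almost permuted by each `g ∈ E`, up to an error `ε` measured by `u` and up
to `d` exceptions. -/
def IsAlmostPermuted {G K : Type*} [Mul G] [PseudoMetricSpace K] (u : G → K) (E : Finset G)
    (ε : ℝ) (d : ℕ) {n : ℕ} (x : Fin n → G) : Prop :=
  ∀ g ∈ E, ∃ φ : Fin n → Fin n ⊕ Fin d, Function.Injective φ ∧
    ∀ i j, φ i = Sum.inl j → dist (u (g * x i)) (u (x j)) < ε

section matching

variable {G : Type*} [Group G] [TopologicalSpace G] [IsTopologicalGroup G]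

/-- Each member `J i` of a minimal refinement of the join lies in some `V₁ i ∈ 𝒱`, and `g * J i` in
some `V₂ i ∈ 𝒱`. Join `i` to `j` when `V₂ i` meets `V₁ j`; then `u (g * x i)` and `u (x j)` are
close through a common point. -/
theorem exists_isAlmostPermuted_of_complexity {K : Type*} [PseudoMetricSpace K] {u : G → K}
    {ε : ℝ} (E : Finset G) {𝒱 : Set (Set G)}
    (h𝒱 : 𝒱 ∈ rightFiniteUniformCovers G)
    (hdiam : ∀ V ∈ 𝒱, ∀ x ∈ V, ∀ y ∈ V, dist (u x) (u y) < ε) {F : Finset G}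
    (h1F : 1 ∈ F) (hEF : ∀ g ∈ E, g⁻¹ ∈ F) :
    ∃ n : ℕ, 0 < n ∧ n ≤ rightUniformComplexity (translateJoin F 𝒱) ∧
      ∃ x : Fin n → G, IsAlmostPermuted u E (ε + ε) (n - rightUniformComplexity 𝒱) x := by
  classical
  obtain ⟨𝒲, h𝒲, href, hcard⟩ := exists_refines_ncard_eq_rightUniformComplexity
    (translateJoin_mem_rightFiniteUniformCovers F h𝒱)
  obtain ⟨hfin, W, hW, hWx⟩ := mem_rightFiniteUniformCovers_iff.1 h𝒲
  -- Empty members are discarded so that points can be chosen; the rest is still a uniform covering.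
  have hfin' : {J ∈ 𝒲 | J.Nonempty}.Finite := hfin.subset (sep_subset _ _)
  let t : Finset (Set G) := hfin'.toFinset
  have ht : ∀ {J}, J ∈ t ↔ J ∈ 𝒲 ∧ J.Nonempty := by simp [t]
  let e := t.equivFin
  let J : Fin t.card → Set G := fun i => (e.symm i : Set G)
  have hJ : ∀ i, J i ∈ 𝒲 ∧ (J i).Nonempty := fun i => ht.1 (e.symm i).2
  have hcov : ∀ x, ∃ i, ∀ w ∈ W, w * x ∈ J i := by
    intro x
    obtain ⟨V, hV, hVx⟩ := hWx x
    refine ⟨e ⟨V, ht.2 ⟨hV, _, hVx 1 (mem_of_mem_nhds hW)⟩⟩, ?_⟩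
    simpa [J] using hVx
  have hV : ∀ g ∈ F, ∀ i, ∃ V ∈ 𝒱, ∀ x ∈ J i, g⁻¹ * x ∈ V := by
    intro g hg i
    obtain ⟨S, hS, hJS⟩ := href _ (hJ i).1
    obtain ⟨V, hV, rfl⟩ := mem_translateJoin.1 hS
    exact ⟨V ⟨g, hg⟩, hV _, fun x hx => hJS hx ⟨g, hg⟩⟩
  choose x hx using fun i => (hJ i).2
  choose V₁ hV₁ hxV₁ using hV 1 h1F
  refine ⟨t.card, (hcov 1).elim fun i _ => i.pos, ?_, x, fun g hg => ?_⟩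
  · rw [← hcard, ncard_eq_toFinset_card _ hfin]
    exact Finset.card_le_card fun s hs => by simpa using (ht.1 hs).1
  choose V₂ hV₂ hxV₂ using hV _ (hEF g hg)
  obtain ⟨φ, hφ, hφr⟩ := exists_injective_sum_of_card_le_biUnion_add
    (fun i => Finset.univ.filter fun j => (V₂ i ∩ V₁ j).Nonempty)
    (t.card - rightUniformComplexity 𝒱) fun S => by
      set r := fun i => Finset.univ.filter fun j => (V₂ i ∩ V₁ j).Nonempty
      -- The sets `V₂ i` with `i ∉ S` and the sets `V₁ j` with `j` a neighbour of `S` form a uniform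
      -- covering refining 𝒱, so they number at least `N(𝒱)`. This is Hall's condition.
      have hle : rightUniformComplexity 𝒱 ≤ Fintype.card ((Sᶜ : Finset _) ⊕ S.biUnion r) := by
        refine rightUniformComplexity_le (Sum.elim (fun i => V₂ i) fun j => V₁ j) ?_ ?_
        · rintro (i | j)
          · exact ⟨_, hV₂ i, subset_rfl⟩
          · exact ⟨_, hV₁ j, subset_rfl⟩
        · obtain ⟨W', hW', hc⟩ := eventually_conj_mem {g} hW
          refine ⟨W ∩ W', inter_mem hW hW', fun z => ?_⟩
          obtain ⟨i, hi⟩ := hcov (g⁻¹ * z)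
          obtain ⟨j, hj⟩ := hcov z
          have h2 : ∀ w ∈ W ∩ W', w * z ∈ V₂ i := fun w hw => by
            simpa [mul_assoc] using hxV₂ i _ (hi _ (hc g (by simp) w hw.2))
          have h1 : ∀ w ∈ W ∩ W', w * z ∈ V₁ j := fun w hw => by
            simpa using hxV₁ j _ (hj w hw.1)
          by_cases hiS : i ∈ S
          · refine ⟨Sum.inr ⟨j, ?_⟩, h1⟩
            have := mem_of_mem_nhds (inter_mem hW hW')
            exact Finset.mem_biUnion.2 ⟨i, hiS, by
              simpa [r] using ⟨z, by simpa using h2 1 this, by simpa using h1 1 this⟩⟩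
          · exact ⟨Sum.inl ⟨i, by simpa using hiS⟩, h2⟩
      rw [Fintype.card_sum, Fintype.card_coe, Fintype.card_coe, Finset.card_compl,
        Fintype.card_fin] at hle
      have := Finset.card_le_univ S
      rw [Fintype.card_fin] at this
      omega
  refine ⟨φ, hφ, fun i j hij => ?_⟩
  obtain ⟨z, hz2, hz1⟩ := (Finset.mem_filter.1 (hφr i j hij)).2
  have h2 : g * x i ∈ V₂ i := by simpa using hxV₂ i _ (hx i)
  have h1 : x j ∈ V₁ j := by simpa using hxV₁ j _ (hx j)
  exact (dist_triangle _ (u z) _).trans_lt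
    (add_lt_add (hdiam _ (hV₂ i) _ h2 _ hz2) (hdiam _ (hV₁ j) _ hz1 _ h1))

end matching

/-! ### From almost permuted points to an invariant mean -/

/-- Partially matched finite families of numbers have almost the same sum. -/
theorem abs_sum_sub_sum_le_of_injective {κ : Type*} [Fintype κ] {d : ℕ}
    {φ : κ → κ ⊕ Fin d} (hφ : Function.Injective φ) {a b : κ → ℝ} {C ε : ℝ} (hC : 0 ≤ C) (hε : 0 ≤ ε)
    (ha : ∀ i, |a i| ≤ C) (hb : ∀ i, |b i| ≤ C)
    (h : ∀ i j, φ i = Sum.inl j → |a i - b j| ≤ ε) :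
    |∑ i, a i - ∑ i, b i| ≤ ε * Fintype.card κ + 2 * C * d := by
  classical
  -- Dummies get value 0 in `b'` and are counted by `c`. At most `d` indices go to dummies, and
  -- exactly `d` elements of `κ ⊕ Fin d` are missed by `φ`; each costs at most `C`.
  let b' : κ ⊕ Fin d → ℝ := Sum.elim b 0
  let c : κ ⊕ Fin d → ℝ := Sum.elim 0 1
  have hb' : ∀ s, |b' s| ≤ C := by rintro (i | i) <;> simp [b', hb, hC]
  have h1 : |∑ i, (a i - b' (φ i))| ≤ ε * Fintype.card κ + C * d := by
    calc |∑ i, (a i - b' (φ i))| ≤ ∑ i, |a i - b' (φ i)| := Finset.abs_sum_le_sum_abs _ _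
      _ ≤ ∑ i, (ε + C * c (φ i)) := Finset.sum_le_sum fun i _ => by
          rcases hi : φ i with j | j
          · simpa [b', c] using h i j hi
          · simpa [b', c] using (ha i).trans (le_add_of_nonneg_left hε)
      _ = ε * Fintype.card κ + C * ∑ s ∈ Finset.univ.image φ, c s := by
          rw [Finset.sum_add_distrib, Finset.sum_image fun _ _ _ _ h => hφ h, Finset.mul_sum]
          simp [mul_comm]
      _ ≤ ε * Fintype.card κ + C * ∑ s, c s := by
          gcongr
          · rintro (i | i) - - <;> simp [c]
          · exact Finset.subset_univ _
      _ = ε * Fintype.card κ + C * d := by simp [c]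
  have h2 : |∑ s, b' s - ∑ i, b' (φ i)| ≤ C * d := by
    rw [← Finset.sum_image (f := b') (g := φ) fun _ _ _ _ h => hφ h,
      ← Finset.sum_sdiff (Finset.subset_univ (Finset.univ.image φ)), add_sub_cancel_right]
    refine (Finset.abs_sum_le_sum_abs _ _).trans ((Finset.sum_le_sum fun s _ => hb' s).trans ?_)
    rw [Finset.sum_const, Finset.card_sdiff_of_subset (Finset.subset_univ _),
      Finset.card_image_of_injective _ hφ]
    simp [mul_comm]
  have h3 : ∑ s, b' s = ∑ i, b i := by simp [b']
  rw [Finset.sum_sub_distrib] at h1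
  rw [h3] at h2
  rw [abs_le] at *
  constructor <;> linarith [h1.1, h1.2, h2.1, h2.2]

theorem IsAlmostPermuted.abs_sum_sub_sum_le {G K : Type*} [Mul G] [PseudoMetricSpace K]
    {u : G → K} {E : Finset G} {ε : ℝ} {d n : ℕ} {x : Fin n → G}
    (h : IsAlmostPermuted u E ε d x) (hε : 0 ≤ ε) {f : G → ℝ} {C : ℝ} (hC : ∀ y, |f y| ≤ C)
    (hf : ∀ y z, |f y - f z| ≤ dist (u y) (u z)) {g : G} (hg : g ∈ E) :
    |∑ i, f (g * x i) - ∑ i, f (x i)| ≤ ε * n + 2 * C * d := by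
  obtain ⟨φ, hφ, hd⟩ := h g hg
  simpa using abs_sum_sub_sum_le_of_injective hφ (a := fun i => f (g * x i)) (b := fun i => f (x i))
    ((abs_nonneg _).trans (hC g)) hε (fun i => hC _) (fun i => hC _)
    fun i j hij => (hf _ _).trans (hd i j hij).le

universe u

/-- A topological group with finite sets that are almost permuted by left translations is
amenable. -/
theorem isAmenableTopologicalGroup_of_isAlmostPermuted {G : Type u} [Group G] [TopologicalSpace G]
    [IsTopologicalGroup G]
    (h : ∀ (K : Type u) [PseudoMetricSpace K] [CompactSpace K] (u : G → K),
      @UniformContinuous G K (IsTopologicalGroup.rightUniformSpace G) _ u →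
      ∀ (E : Finset G) (ε : ℝ), 0 < ε → ∃ (n d : ℕ) (x : Fin n → G), 0 < n ∧ (d : ℝ) ≤ ε * n ∧
        IsAlmostPermuted u E ε d x) :
    IsAmenableTopologicalGroup G := by
  classical
  let : UniformSpace G := IsTopologicalGroup.rightUniformSpace G
  choose C hC using fun f : rightUCb G => f.2.2
  have hC0 : ∀ f, 0 ≤ C f := fun f => (abs_nonneg _).trans (hC f 1)
  have key : ∀ i : Finset G × Finset (rightUCb G) × ℕ, ∃ (n : ℕ) (x : Fin n → G), 0 < n ∧
      ∀ g ∈ i.1, ∀ f ∈ i.2.1, |∑ j, (f : G → ℝ) (g * x j) - ∑ j, (f : G → ℝ) (x j)| ≤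
        (1 + 2 * C f) * (1 / (i.2.2 + 1 : ℝ)) * n := by
    rintro ⟨E, Φ, k⟩
    -- The finitely many functions are bundled into one map to a compact product of intervals.
    let u : G → (∀ f : Φ, Icc (-C f) (C f)) := fun x f => ⟨(f : rightUCb G).1 x, abs_le.1 (hC f x)⟩
    have hu : UniformContinuous u :=
      uniformContinuous_pi.2 fun f => (f : rightUCb G).2.1.subtype_mk _
    have hk : (0 : ℝ) < 1 / (k + 1 : ℝ) := by positivity
    obtain ⟨n, d, x, hn, hd, hx⟩ := h _ u hu E _ hk
    refine ⟨n, x, hn, fun g hg f hf => ?_⟩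
    refine (hx.abs_sum_sub_sum_le hk.le (hC f) (fun y z => ?_) hg).trans ?_
    · exact dist_le_pi_dist (u y) (u z) ⟨f, hf⟩
    · have := mul_le_mul_of_nonneg_left hd (hC0 f)
      linarith
  choose n x hn hx using key
  let A : Finset G × Finset (rightUCb G) × ℕ → rightUCb G → ℝ := fun i f =>
    (∑ j, (f : G → ℝ) (x i j)) / n i
  have hn' : ∀ i, (0 : ℝ) < n i := fun i => Nat.cast_pos.2 (hn i)
  have hAle : ∀ i (f : rightUCb G) (c : ℝ), (∀ y, (f : G → ℝ) y ≤ c) → A i f ≤ c := fun i f c hc => by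
    rw [div_le_iff₀ (hn' i)]
    simpa [mul_comm] using Finset.sum_le_sum fun j (_ : j ∈ Finset.univ) => hc (x i j)
  have hleA : ∀ i (f : rightUCb G) (c : ℝ), (∀ y, c ≤ (f : G → ℝ) y) → c ≤ A i f := fun i f c hc => by
    rw [le_div_iff₀ (hn' i)]
    simpa [mul_comm] using Finset.sum_le_sum fun j (_ : j ∈ Finset.univ) => hc (x i j)
  -- An ultrafilter gives every bounded family of averages a limit; refining `atTop` makes the
  -- invariance error vanish.
  let 𝔉 : Ultrafilter (Finset G × Finset (rightUCb G) × ℕ) := Ultrafilter.of atTop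
  have hlim : ∀ f, ∃ c, Tendsto (A · f) 𝔉 (𝓝 c) := fun f => by
    obtain ⟨c, -, hc⟩ := (isCompact_Icc (a := -C f) (b := C f)).ultrafilter_le_nhds
      (𝔉.map (A · f)) (le_principal_iff.2 (Filter.mem_map.2 (univ_mem' fun i =>
        ⟨hleA i f _ fun y => (abs_le.1 (hC f y)).1, hAle i f _ fun y => (abs_le.1 (hC f y)).2⟩)))
    exact ⟨c, hc⟩
  choose m hm using hlim
  refine ⟨{ toFun := m, map_add' := fun f g => ?_, map_smul' := fun c f => ?_ },
    fun f => ⟨?_, ?_⟩, fun g f => ?_⟩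
  · refine tendsto_nhds_unique (hm (f + g)) (((hm f).add (hm g)).congr fun i => ?_)
    simp [A, Finset.sum_add_distrib, add_div]
  · refine tendsto_nhds_unique (hm (c • f)) (((hm f).const_mul c).congr fun i => ?_)
    simp [A, ← Finset.mul_sum, mul_div_assoc]
  · exact ge_of_tendsto' (hm f) fun i => hleA i f _ fun y =>
      ciInf_le ⟨-C f, forall_mem_range.2 fun y => (abs_le.1 (hC f y)).1⟩ y
  · exact le_of_tendsto' (hm f) fun i => hAle i f _ fun y =>
      le_ciSup ⟨C f, forall_mem_range.2 fun y => (abs_le.1 (hC f y)).2⟩ y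
  · have hbound : ∀ k : ℕ, |m (rightUCb.translate g f) - m f| ≤
        (1 + 2 * C f) * (1 / (k + 1 : ℝ)) := fun k => by
      refine le_of_tendsto ((hm (rightUCb.translate g f)).sub (hm f)).abs ?_
      refine Ultrafilter.of_le atTop ?_
      filter_upwards [eventually_ge_atTop (({g}, {f}, k) : Finset G × Finset (rightUCb G) × ℕ)]
        with i hi
      have h1 := hx i g (hi.1 (by simp)) f (hi.2.1 (by simp))
      have hk : (k : ℝ) ≤ i.2.2 := Nat.cast_le.2 hi.2.2
      have : A i (rightUCb.translate g f) - A i f =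
          (∑ j, (f : G → ℝ) (g * x i j) - ∑ j, (f : G → ℝ) (x i j)) / n i := by
        rw [sub_div]; rfl
      rw [this, abs_div, abs_of_pos (hn' i), div_le_iff₀ (hn' i)]
      refine h1.trans ?_
      have := hC0 f
      gcongr
    have := ge_of_tendsto' (tendsto_one_div_add_atTop_nhds_zero_nat.const_mul (1 + 2 * C f)) hbound
    rw [mul_zero] at this
    exact sub_eq_zero.1 (abs_nonpos_iff.1 this)

/-! ### From an invariant mean to almost permuted points -/

section day

variable {G : Type*} [Group G] [TopologicalSpace G] [IsTopologicalGroup G]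

/-- Otherwise a separating functional `l` combines the differences into a function bounded below by
some `c > 0`, although invariance forces its mean to be 0. -/
theorem IsAmenableTopologicalGroup.zero_mem_closure_convexHull (hG : IsAmenableTopologicalGroup G)
    {ι : Type*} [Fintype ι] (g : ι → G) (f : ι → rightUCb G) :
    (0 : ι → ℝ) ∈ closure (convexHull ℝ
      (range fun x i => (f i : G → ℝ) (g i * x) - (f i : G → ℝ) x)) := by
  classical
  obtain ⟨m, hm, hinv⟩ := hG
  by_contra hcon
  obtain ⟨l, c, hc, hl⟩ := geometric_hahn_banach_point_closed
    (convex_convexHull ℝ _).closure isClosed_closure hcon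
  let F : rightUCb G := ∑ i, l (Pi.single i 1) • (rightUCb.translate (g i) (f i) - f i)
  have hF : m F = 0 := by simp [F, hinv]
  have hFc : ∀ x, c ≤ (F : G → ℝ) x := fun x => by
    have h := hl _ (subset_closure (subset_convexHull ℝ _ ⟨x, rfl⟩))
    refine h.le.trans_eq ?_
    rw [← ContinuousLinearMap.coe_coe, LinearMap.pi_apply_eq_sum_univ]
    simp only [F, rightUCb.translate, AddSubmonoidClass.coe_finsetSum, Finset.sum_apply,
      Submodule.coe_smul, Submodule.coe_sub, Pi.smul_apply, Pi.sub_apply, smul_eq_mul, mul_comm]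
    refine Finset.sum_congr rfl fun i _ => ?_
    rw [show (Pi.single i 1 : ι → ℝ) = fun j => if i = j then 1 else 0 from
      funext fun j => by simp [Pi.single_apply, eq_comm]]
    rfl
  have := (hm F).1
  rw [hF] at this
  rw [map_zero] at hc
  exact absurd (le_ciInf hFc) (by linarith)

/-- Convex combinations are approximated by averages with equal weights. -/
theorem exists_equal_weights_of_mem_convexHull {X ι : Type*} [Fintype ι] {T : X → ι → ℝ}
    (h : (0 : ι → ℝ) ∈ closure (convexHull ℝ (range T))) {ε : ℝ} (hε : 0 < ε) (L : ℕ) :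
    ∃ (n : ℕ) (x : Fin n → X), L ≤ n ∧ ∀ i, |∑ j, T (x j) i| ≤ ε * n := by
  obtain ⟨v, hv, hvε⟩ := Metric.mem_closure_iff.1 h (ε / 2) (by positivity)
  obtain ⟨κ, _, w, z, hw, hw1, hz, rfl⟩ := mem_convexHull_iff_exists_fintype.1 hv
  choose y hy using hz
  let B : ℝ := ∑ k, ∑ i, |T (y k) i|
  -- Repeating `y k` about `M * w k` times, rounded down, costs at most `B` in each sum and `card κ`
  -- in the number of points. The bound on `M` ensures `M * (ε / 2) + B ≤ ε * (M - card κ)` and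
  -- leaves at least `L` points.
  obtain ⟨M, hM⟩ := exists_nat_ge (2 * (B / ε + Fintype.card κ) + L)
  have hB : 0 ≤ B := Finset.sum_nonneg fun _ _ => Finset.sum_nonneg fun _ _ => abs_nonneg _
  have hBε : 0 ≤ B / ε := by positivity
  let q : κ → ℕ := fun k => ⌊M * w k⌋₊
  have hq : ∀ k, (q k : ℝ) ≤ M * w k := fun k => Nat.floor_le (by have := hw k; positivity)
  have hq' : ∀ k, M * w k ≤ q k + 1 := fun k => (Nat.lt_floor_add_one _).le
  let e := Fintype.equivFin (Σ k, Fin (q k))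
  have hcard : (M : ℝ) - Fintype.card κ ≤ (Fintype.card (Σ k, Fin (q k)) : ℝ) := by
    have := Finset.sum_le_sum fun k (_ : k ∈ Finset.univ) => hq' k
    rw [← Finset.mul_sum, hw1, Finset.sum_add_distrib] at this
    simp at this ⊢
    linarith
  refine ⟨_, fun j => y (e.symm j).1, ?_, fun i => ?_⟩
  · have : (L : ℝ) ≤ Fintype.card (Σ k, Fin (q k)) := by linarith
    exact_mod_cast this
  · have h1 : ∑ j, T (y (e.symm j).1) i = ∑ k, q k * T (y k) i := by
      rw [e.symm.sum_comp (fun s => T (y s.1) i), Fintype.sum_sigma]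
      simp
    have h2 : |∑ k, w k * T (y k) i| ≤ ε / 2 := by
      have := (dist_le_pi_dist (0 : ι → ℝ) _ i).trans hvε.le
      simpa [Real.dist_eq, ← hy] using this
    have h3 : |∑ k, q k * T (y k) i - M * ∑ k, w k * T (y k) i| ≤ B := by
      rw [Finset.mul_sum, ← Finset.sum_sub_distrib]
      refine (Finset.abs_sum_le_sum_abs _ _).trans (Finset.sum_le_sum fun k _ => ?_)
      calc |q k * T (y k) i - M * (w k * T (y k) i)| = |q k - M * w k| * |T (y k) i| := by
            rw [← abs_mul]; ring_nf
        _ ≤ 1 * |T (y k) i| := by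
            gcongr
            rw [abs_le]
            constructor <;> linarith [hq k, hq' k]
        _ ≤ ∑ i, |T (y k) i| := by
            rw [one_mul]
            exact Finset.single_le_sum (f := fun i => |T (y k) i|) (fun _ _ => abs_nonneg _)
              (Finset.mem_univ i)
    have h4 : |M * ∑ k, w k * T (y k) i| ≤ M * (ε / 2) := by
      rw [abs_mul, Nat.abs_cast]; gcongr
    rw [h1]
    have h5 : B = B / ε * ε := by field_simp
    have h6 : ε * (M - Fintype.card κ) ≤ ε * Fintype.card (Σ k, Fin (q k)) := by gcongr
    have h7 : ε * (2 * (B / ε + Fintype.card κ) + L) ≤ ε * M := by gcongr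
    have h8 : 0 ≤ ε * L := by positivity
    have h9 := abs_sub_abs_le_abs_sub (∑ k, q k * T (y k) i) (M * ∑ k, w k * T (y k) i)
    linarith

theorem IsAmenableTopologicalGroup.exists_almost_invariant_sums (hG : IsAmenableTopologicalGroup G)
    {ι : Type*} [Fintype ι] (f : ι → rightUCb G) (E : Finset G) {ε : ℝ} (hε : 0 < ε) (L : ℕ) :
    ∃ (n : ℕ) (x : Fin n → G), L ≤ n ∧ ∀ g ∈ E, ∀ i,
      |∑ j, (f i : G → ℝ) (g * x j) - ∑ j, (f i : G → ℝ) (x j)| ≤ ε * n := by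
  obtain ⟨n, x, hn, hx⟩ := exists_equal_weights_of_mem_convexHull
    (hG.zero_mem_closure_convexHull (fun i : E × ι => (i.1 : G)) fun i => f i.2) hε L
  refine ⟨n, x, hn, fun g hg i => ?_⟩
  rw [← Finset.sum_sub_distrib]
  exact hx (⟨g, hg⟩, i)

/-- Almost invariant sums of a partition of unity with small supports say that the points and their
translates are distributed over `K` in nearly the same way; Hall's theorem makes this a matching. -/
theorem IsAmenableTopologicalGroup.exists_isAlmostPermuted (hG : IsAmenableTopologicalGroup G)
    {K : Type*} [MetricSpace K] [CompactSpace K] {u : G → K}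
    (hu : @UniformContinuous G K (IsTopologicalGroup.rightUniformSpace G) _ u) (E : Finset G)
    {δ ε : ℝ} (hδ : 0 < δ) (hε : 0 < ε) (L : ℕ) :
    ∃ (n d : ℕ) (x : Fin n → G), L ≤ n ∧ (d : ℝ) ≤ ε * n ∧ IsAlmostPermuted u E δ d x := by
  classical
  let : UniformSpace G := IsTopologicalGroup.rightUniformSpace G
  obtain ⟨t, ht, htc⟩ := Metric.totallyBounded_iff.1 (isCompact_univ (X := K)).totallyBounded
    (δ / 2) (by positivity)
  have := ht.fintype
  obtain ⟨ρ, hρ⟩ := PartitionOfUnity.exists_isSubordinate (X := K) isClosed_univ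
    (fun c : t => Metric.ball (c : K) (δ / 2)) (fun _ => Metric.isOpen_ball)
    (by rwa [biUnion_eq_iUnion] at htc)
  have hsum : ∀ z, ∑ c, ρ c z = 1 := fun z => by
    rw [← finsum_eq_sum_of_fintype]; exact ρ.sum_eq_one (mem_univ z)
  have hball : ∀ c z, ρ c z ≠ 0 → dist z c < δ / 2 := fun c z hz =>
    hρ c (subset_tsupport _ hz)
  let f : t → rightUCb G := fun c => ⟨fun x => ρ c (u x),
    (CompactSpace.uniformContinuous_of_continuous (ρ c).continuous).comp hu, 1, fun x => by
      rw [abs_of_nonneg (ρ.nonneg c _)]; exact ρ.le_one c _⟩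
  have hε' : 0 < ε / (t.ncard + 1) := by positivity
  obtain ⟨n, x, hn, hx⟩ := hG.exists_almost_invariant_sums f E hε' L
  refine ⟨n, ⌊ε * n⌋₊, x, hn, Nat.floor_le (by positivity), fun g hg => ?_⟩
  let r : Fin n → Finset (Fin n) := fun i =>
    Finset.univ.filter fun j => ∃ c, ρ c (u (g * x i)) ≠ 0 ∧ ρ c (u (x j)) ≠ 0
  obtain ⟨φ, hφ, hφr⟩ := exists_injective_sum_of_card_le_biUnion_add r ⌊ε * n⌋₊ fun S => by
    let I : Finset t := Finset.univ.filter fun c => ∃ i ∈ S, ρ c (u (g * x i)) ≠ 0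
    -- `I` collects the bump functions seen by the translates from `S`. Their mass at the translates
    -- is at least `|S|`; at the original points it lives on the neighbours of `S`, hence is at most
    -- their number. Almost invariance compares the two.
    have h1 : (S.card : ℝ) ≤ ∑ c ∈ I, ∑ i, ρ c (u (g * x i)) := by
      calc (S.card : ℝ) = ∑ i ∈ S, ∑ c, ρ c (u (g * x i)) := by simp [hsum]
        _ = ∑ i ∈ S, ∑ c ∈ I, ρ c (u (g * x i)) := by
          refine Finset.sum_congr rfl fun i hi => (Finset.sum_subset (Finset.subset_univ _) ?_).symm
          intro c _ hc
          by_contra hne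
          exact hc (Finset.mem_filter.2 ⟨Finset.mem_univ _, i, hi, hne⟩)
        _ ≤ ∑ i, ∑ c ∈ I, ρ c (u (g * x i)) :=
          Finset.sum_le_sum_of_subset_of_nonneg (Finset.subset_univ _) fun _ _ _ =>
            Finset.sum_nonneg fun _ _ => ρ.nonneg _ _
        _ = _ := Finset.sum_comm
    have h2 : ∑ c ∈ I, ∑ i, ρ c (u (g * x i)) ≤
        ∑ c ∈ I, (∑ j, ρ c (u (x j)) + ε / (t.ncard + 1) * n) :=
      Finset.sum_le_sum fun c _ => by linarith [(abs_le.1 (hx g hg c)).2]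
    have h3 : ∑ c ∈ I, ∑ j, ρ c (u (x j)) ≤ ((S.biUnion r).card : ℝ) := by
      rw [Finset.sum_comm, ← Finset.sum_subset (Finset.subset_univ (S.biUnion r))]
      · calc _ ≤ ∑ j ∈ S.biUnion r, (1 : ℝ) := Finset.sum_le_sum fun j _ => by
              rw [← hsum (u (x j))]
              exact Finset.sum_le_sum_of_subset_of_nonneg (Finset.subset_univ _) fun _ _ _ =>
                ρ.nonneg _ _
          _ = _ := by simp
      · intro j _ hj
        refine Finset.sum_eq_zero fun c hc => ?_
        by_contra hne
        obtain ⟨i, hi, hci⟩ := (Finset.mem_filter.1 hc).2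
        exact hj (Finset.mem_biUnion.2 ⟨i, hi, Finset.mem_filter.2
          ⟨Finset.mem_univ _, c, hci, hne⟩⟩)
    have h4 : (I.card : ℝ) * (ε / (t.ncard + 1) * n) ≤ ε * n := by
      have : (I.card : ℝ) ≤ t.ncard + 1 := by
        have := Finset.card_le_univ I
        rw [← Nat.card_eq_fintype_card, Nat.card_coe_set_eq] at this
        exact_mod_cast this.trans (Nat.le_succ _)
      calc (I.card : ℝ) * (ε / (t.ncard + 1) * n) ≤ (t.ncard + 1) * (ε / (t.ncard + 1) * n) := by
            gcongr
        _ = ε * n := by field_simp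
    rw [Finset.sum_add_distrib, Finset.sum_const, nsmul_eq_mul] at h2
    have h5 : S.card - (S.biUnion r).card ≤ ⌊ε * n⌋₊ := Nat.le_floor (by
      rcases le_total S.card (S.biUnion r).card with hle | hle
      · rw [Nat.sub_eq_zero_of_le hle, Nat.cast_zero]; positivity
      · rw [Nat.cast_sub hle]; linarith)
    omega
  refine ⟨φ, hφ, fun i j hij => ?_⟩
  obtain ⟨c, hi, hj⟩ := (Finset.mem_filter.1 (hφr i j hij)).2
  linarith [dist_triangle_right (u (g * x i)) (u (x j)) c, hball c _ hi, hball c _ hj]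

end day

/-! ### Coverings built from labelled points -/

section construction

variable {G : Type*} [Group G] [TopologicalSpace G] [IsTopologicalGroup G]

/-- In a non-discrete group, finitely many points can be moved slightly such that their translates
by a finite set are distinct. -/
theorem exists_perturbation [T1Space G] (hG : ¬ DiscreteTopology G) {ι : Type*} [Finite ι]
    (E : Finset G) {x : ι → G} {O : ι → Set G} (hO : ∀ i, O i ∈ 𝓝 (x i)) :
    ∃ y : ι → G, (∀ i, y i ∈ O i) ∧ ∀ g ∈ E, ∀ h ∈ E, ∀ i j, g * y i = h * y j → i = j := by
  classical
  have := Fintype.ofFinite ι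
  have hinf : ∀ i, (O i).Infinite := fun i => by
    have : (𝓝[≠] (x i)).NeBot := by
      by_contra hcon
      rw [not_neBot, ← isOpen_singleton_iff_punctured_nhds] at hcon
      refine hG (discreteTopology_of_isOpen_singleton_one ?_)
      simpa using hcon.preimage (continuous_const_mul (x i))
    exact infinite_of_mem_nhds (x i) (hO i)
  suffices h : ∀ s : Finset ι, ∃ y : ι → G, (∀ i, y i ∈ O i) ∧
      ∀ g ∈ E, ∀ h ∈ E, ∀ i ∈ s, ∀ j ∈ s, g * y i = h * y j → i = j by
    obtain ⟨y, hy, h⟩ := h Finset.univ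
    exact ⟨y, hy, fun g hg k hk i j => h g hg k hk i (Finset.mem_univ _) j (Finset.mem_univ _)⟩
  intro s
  induction s using Finset.induction_on with
  | empty => exact ⟨x, fun i => mem_of_mem_nhds (hO i), by simp⟩
  | insert a s ha ih =>
    obtain ⟨y, hy, hinj⟩ := ih
    obtain ⟨z, hz, hzn⟩ := (hinf a).exists_notMem_finset
      ((E ×ˢ E ×ˢ s).image fun p => p.1⁻¹ * (p.2.1 * y p.2.2))
    have hne : ∀ g ∈ E, ∀ h ∈ E, ∀ j ∈ s, g * z ≠ h * y j := fun g hg h hh j hj heq =>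
      hzn (Finset.mem_image.2 ⟨(g, h, j), by simp [hg, hh, hj], by simp [← heq]⟩)
    have hupd : ∀ j ∈ s, Function.update y a z j = y j := fun j hj =>
      Function.update_of_ne (by rintro rfl; exact ha hj) _ _
    refine ⟨Function.update y a z, fun i => ?_, fun g hg h hh i hi j hj heq => ?_⟩
    · rcases eq_or_ne i a with rfl | hia
      · simpa using hz
      · simpa [hia] using hy i
    · rcases Finset.mem_insert.1 hi with rfl | hi' <;> rcases Finset.mem_insert.1 hj with rfl | hj'
      · rfl
      · rw [Function.update_self, hupd j hj'] at heq
        exact (hne g hg h hh j hj' heq).elim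
      · rw [Function.update_self, hupd i hi'] at heq
        exact (hne h hh g hg i hi' heq.symm).elim
      · rw [hupd i hi', hupd j hj'] at heq
        exact hinj g hg h hh i hi' j hj' heq

/-- The points `x i` are private to members `V i` of a refinement `𝒱` of `𝒰`, and their translates
with the same label are covered by a common member of the join of the translates of `𝒱`. -/
theorem exists_cover_of_labelling [T1Space G] {𝒰 : Set (Set G)} (h𝒰 : 𝒰.Finite) {W₀ : Set G}
    (hW₀ : W₀ ∈ 𝓝 (1 : G)) (hcov : ∀ z, ∃ U ∈ 𝒰, ∀ w ∈ W₀, w * z ∈ U) (E : Finset G) {n : ℕ}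
    (x : Fin n → G) (hxinj : Function.Injective x)
    (hx : ∀ g ∈ E, ∀ h ∈ E, ∀ i j, g * x i = h * x j → i = j)
    {Λ : Type*} [Fintype Λ] (lab : E → Fin n → Λ) (hlab : ∀ g, Function.Injective (lab g))
    (hP : ∀ j, ∃ U ∈ 𝒰, ∀ w ∈ W₀, w * x j ∈ U ∧
      ∀ g h j', lab h j = lab g j' → w * ((h : G)⁻¹ * (g * x j')) ∈ U)
    (hQ : ∀ (g : E) (l : Λ), ∃ U ∈ 𝒰, ∀ h j, lab h j = l →
      ∀ w ∈ W₀, w * ((g : G)⁻¹ * (h * x j)) ∈ U) :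
    ∃ 𝒱 ∈ rightFiniteUniformCovers G, UniformCover.Refines 𝒱 𝒰 ∧
      n ≤ rightUniformComplexity 𝒱 ∧
      rightUniformComplexity (translateJoin E 𝒱) ≤ Fintype.card Λ + 𝒰.ncard ^ E.card := by
  classical
  have hxE : ∀ (g h : E) i j, (h : G)⁻¹ * (g * x i) = x j → i = j ∧ g = h := by
    intro g h i j heq
    rw [inv_mul_eq_iff_eq_mul] at heq
    obtain rfl := hx g g.2 h h.2 i j heq
    exact ⟨rfl, Subtype.ext (mul_right_cancel heq)⟩
  have hne : ∀ p y : G, ∀ᶠ w in 𝓝 (1 : G), w * p = y → p = y := by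
    intro p y
    by_cases hpy : p = y
    · exact Eventually.of_forall fun _ _ => hpy
    · have : Continuous fun w : G => w * p := by fun_prop
      filter_upwards [this.continuousAt.eventually_ne (x := 1) (y := y) (by simpa using hpy)]
        with w hw h
      exact (hw h).elim
  -- `W` is so small that moving one of the relevant points by `W` reaches some `x i` only if the
  -- point was `x i` already.
  obtain ⟨W, hW, hWW₀, hWx, hWq⟩ : ∃ W ∈ 𝓝 (1 : G), W ⊆ W₀ ∧
      (∀ w ∈ W, ∀ i j, w * x j = x i → x j = x i) ∧
      ∀ w ∈ W, ∀ (g h : E) i j, w * ((h : G)⁻¹ * (g * x j)) = x i →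
        (h : G)⁻¹ * (g * x j) = x i := by
    have h1 : ∀ᶠ w in 𝓝 (1 : G), ∀ i j, w * x j = x i → x j = x i :=
      eventually_all.2 fun i => eventually_all.2 fun j => hne _ _
    have h2 : ∀ᶠ w in 𝓝 (1 : G), ∀ (g h : E) i j, w * ((h : G)⁻¹ * (g * x j)) = x i →
        (h : G)⁻¹ * (g * x j) = x i :=
      eventually_all.2 fun g => eventually_all.2 fun h => eventually_all.2 fun i =>
        eventually_all.2 fun j => hne _ _
    exact ⟨_, inter_mem hW₀ (inter_mem h1 h2), inter_subset_left, fun w hw => hw.2.1,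
      fun w hw => hw.2.2⟩
  let P : Fin n → Set G := fun j => insert (x j)
    {p | ∃ g h j', lab h j = lab g j' ∧ p = (h : G)⁻¹ * (g * x j')}
  let V : Fin n → Set G := fun j => {z | ∃ w ∈ W, ∃ p ∈ P j, z = w * p}
  let R : Set G → Set G := fun U => U \ range x
  have hVx : ∀ i j, x i ∈ V j → i = j := by
    rintro i j ⟨w, hw, p, rfl | ⟨g, h, j', hl, rfl⟩, heq⟩
    · exact hxinj (hWx w hw i j heq.symm).symm
    · obtain ⟨rfl, rfl⟩ := hxE g h j' i (hWq w hw g h i j' heq.symm)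
      exact (hlab g hl).symm
  let 𝒱 : Set (Set G) := range V ∪ R '' 𝒰
  have hV𝒱 : ∀ j, V j ∈ 𝒱 := fun j => Or.inl ⟨j, rfl⟩
  have hR𝒱 : ∀ U ∈ 𝒰, R U ∈ 𝒱 := fun U hU => Or.inr ⟨U, hU, rfl⟩
  have h𝒱 : 𝒱 ∈ rightFiniteUniformCovers G := by
    refine mem_rightFiniteUniformCovers_iff.2 ⟨(finite_range V).union (h𝒰.image R), ?_⟩
    -- If `W' * z` hits `x i`, division puts it inside `W * x i ⊆ V i`; if it hits no `x i`,
    -- removing these points from `U` does no harm.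
    obtain ⟨W', hW', hdiv⟩ := exists_nhds_split_inv hW
    refine ⟨W' ∩ W₀, inter_mem hW' hW₀, fun z => ?_⟩
    by_cases hz : ∃ w ∈ W', ∃ i, w * z = x i
    · obtain ⟨w, hw, i, hwi⟩ := hz
      refine ⟨V i, hV𝒱 i, fun w' hw' => ⟨w' / w, hdiv _ hw'.1 _ hw, x i, mem_insert _ _, ?_⟩⟩
      simp [← hwi, mul_assoc, div_eq_mul_inv]
    · push Not at hz
      obtain ⟨U, hU, hUz⟩ := hcov z
      exact ⟨R U, hR𝒱 U hU, fun w hw => ⟨hUz w hw.2, fun ⟨i, hi⟩ => hz w hw.1 i hi.symm⟩⟩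
  refine ⟨𝒱, h𝒱, ?_, ?_, ?_⟩
  · rintro _ (⟨j, rfl⟩ | ⟨U, hU, rfl⟩)
    · obtain ⟨U, hU, h⟩ := hP j
      refine ⟨U, hU, ?_⟩
      rintro _ ⟨w, hw, p, rfl | ⟨g, h', j', hl, rfl⟩, rfl⟩
      · exact (h w (hWW₀ hw)).1
      · exact (h w (hWW₀ hw)).2 g h' j' hl
    · exact ⟨U, hU, sdiff_subset⟩
  · obtain ⟨𝒲, h𝒲, href, hcard⟩ := exists_refines_ncard_eq_rightUniformComplexity h𝒱
    obtain ⟨hfin, W', hW', h⟩ := mem_rightFiniteUniformCovers_iff.1 h𝒲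
    -- A member of a refinement containing `x j` must lie in `V j`, so distinct points need distinct
    -- members.
    choose S hS hSx using fun j => h (x j)
    have hSx' : ∀ j, x j ∈ S j := fun j => by simpa using hSx j 1 (mem_of_mem_nhds hW')
    have hinj : Function.Injective S := by
      intro i j hij
      obtain ⟨T, (⟨k, rfl⟩ | ⟨U, -, rfl⟩), hT⟩ := href _ (hS i)
      · rw [hVx i k (hT (hSx' i)), hVx j k (hT (hij ▸ hSx' j))]
      · exact ((hT (hSx' i)).2 ⟨i, rfl⟩).elim
    rw [← hcard]
    calc n = (range S).ncard := by
          rw [← Nat.card_coe_set_eq, Nat.card_range_of_injective hinj, Nat.card_fin]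
      _ ≤ 𝒲.ncard := ncard_le_ncard (range_subset_iff.2 hS) hfin
  · choose UQ hUQ hUQx using hQ
    -- `A g l` receives the `g⁻¹`-translate of the cluster labelled `l`: it is `V j` if `g * x j`
    -- has that label, and otherwise a member of 𝒰 with the points removed.
    have hA : ∀ (g : E) (l : Λ), ∃ A ∈ 𝒱, (∀ j, lab g j = l → A = V j) ∧
        ((∀ j, lab g j ≠ l) → A = R (UQ g l)) := by
      intro g l
      by_cases hj : ∃ j, lab g j = l
      · obtain ⟨j, rfl⟩ := hj
        exact ⟨V j, hV𝒱 j, fun k hk => by rw [hlab g hk], fun h => (h j rfl).elim⟩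
      · push Not at hj
        exact ⟨_, hR𝒱 _ (hUQ g l), fun j h => (hj j h).elim, fun _ => rfl⟩
    choose A hA𝒱 hAV hAR using hA
    have := h𝒰.fintype
    have hcardκ : Fintype.card (Λ ⊕ (E → 𝒰)) = Fintype.card Λ + 𝒰.ncard ^ E.card := by
      rw [Fintype.card_sum, Fintype.card_fun, Fintype.card_coe, ← Nat.card_coe_set_eq,
        Nat.card_eq_fintype_card]
    rw [← hcardκ]
    -- One member of the join per label handles the places near translates `g * x i`; elsewhere the
    -- `𝒰.ncard ^ E.card` intersections of the sets `R U` suffice.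
    refine rightUniformComplexity_le (Sum.elim (fun l => {z | ∀ g : E, (g : G)⁻¹ * z ∈ A g l})
      fun σ => {z | ∀ g : E, (g : G)⁻¹ * z ∈ R (σ g)}) ?_ ?_
    · rintro (l | σ)
      · exact ⟨_, mem_translateJoin.2 ⟨_, fun g => hA𝒱 g l, rfl⟩, subset_rfl⟩
      · exact ⟨_, mem_translateJoin.2 ⟨_, fun g => hR𝒱 _ (σ g).2, rfl⟩, subset_rfl⟩
    obtain ⟨W₁, hW₁, hconj⟩ := eventually_conj_mem E hW
    obtain ⟨W₂, hW₂, hdiv⟩ := exists_nhds_split_inv hW₁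
    obtain ⟨W₃, hW₃, hconj₀⟩ := eventually_conj_mem E hW₀
    refine ⟨W₂ ∩ W₃, inter_mem hW₂ hW₃, fun z => ?_⟩
    by_cases hz : ∃ w ∈ W₂, ∃ (g : E) (i : Fin n), w * z = g * x i
    · obtain ⟨w, hw, g, i, hwi⟩ := hz
      refine ⟨Sum.inl (lab g i), fun w' hw' h => ?_⟩
      have hw1 := hconj h h.2 _ (hdiv w' hw'.1 w hw)
      have heq : (h : G)⁻¹ * (w' * z) = (h : G)⁻¹ * (w' / w) * h * ((h : G)⁻¹ * (g * x i)) := by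
        simp [← hwi, mul_assoc, div_eq_mul_inv]
      rw [heq]
      by_cases hj : ∃ j, lab h j = lab g i
      · obtain ⟨j, hj⟩ := hj
        rw [hAV h _ j hj]
        exact ⟨_, hw1, _, Or.inr ⟨g, h, i, hj, rfl⟩, rfl⟩
      · push Not at hj
        rw [hAR h _ hj]
        refine ⟨hUQx h _ g i rfl _ (hWW₀ hw1), fun ⟨k, hk⟩ => ?_⟩
        obtain ⟨rfl, rfl⟩ := hxE g h i k (hWq _ hw1 g h k i hk.symm)
        exact hj i rfl
    · push Not at hz
      choose U hU hUz using hcov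
      refine ⟨Sum.inr fun g => ⟨U ((g : G)⁻¹ * z), hU _⟩, fun w hw g => ⟨?_, fun ⟨k, hk⟩ => ?_⟩⟩
      · simpa [mul_assoc] using hUz ((g : G)⁻¹ * z) _ (hconj₀ g g.2 w hw.2)
      · exact hz w hw.1 g k (by simp [hk])

end construction

/-! ### The two implications -/

section main

variable {G : Type*} [Group G] [TopologicalSpace G] [IsTopologicalGroup G]

theorem UniformContinuous.exists_nhds_dist_lt {K : Type*} [PseudoMetricSpace K] {u : G → K}
    (hu : @UniformContinuous G K (IsTopologicalGroup.rightUniformSpace G) _ u) {ε : ℝ}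
    (hε : 0 < ε) : ∃ W ∈ 𝓝 (1 : G), ∀ w ∈ W, ∀ x, dist (u x) (u (w * x)) < ε := by
  let : UniformSpace G := IsTopologicalGroup.rightUniformSpace G
  obtain ⟨W, hW, h⟩ := hu (Metric.dist_mem_uniformity hε)
  exact ⟨W, hW, fun w hw x => h (a := (x, w * x)) (by simpa using hw)⟩

theorem IsAmenableTopologicalGroup.exists_complexity_le [T1Space G]
    (hG : IsAmenableTopologicalGroup G) (hdisc : ¬ DiscreteTopology G) (E : Finset G)
    {𝒰 : Set (Set G)} (h𝒰 : 𝒰 ∈ rightFiniteUniformCovers G) {ε : ℝ} (hε : 0 < ε) :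
    ∃ 𝒱 ∈ rightFiniteUniformCovers G, UniformCover.Refines 𝒱 𝒰 ∧
      (rightUniformComplexity (translateJoin E 𝒱) : ℝ) ≤ (1 + ε) * rightUniformComplexity 𝒱 := by
  classical
  let : UniformSpace G := IsTopologicalGroup.rightUniformSpace G
  obtain ⟨u, hu, hu1, hu0⟩ := UniformCover.IsUniformCover.exists_uniformContinuous h𝒰.2
  have := h𝒰.1.fintype
  obtain ⟨W₀, hW₀, hW₀u⟩ : ∃ W ∈ 𝓝 (1 : G), ∀ w ∈ W, ∀ x U,
      dist (u U x) (u U (w * x)) < 1 / 2 := by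
    have hu' : UniformContinuous fun x U => u U x := uniformContinuous_pi.2 hu
    obtain ⟨W, hW, h⟩ := hu'.exists_nhds_dist_lt (show (0 : ℝ) < 1 / 2 by norm_num)
    exact ⟨W, hW, fun w hw x U => (dist_le_pi_dist _ _ U).trans_lt (h w hw x)⟩
  have hmem : ∀ U p q, u U p = 1 → dist (u U p) (u U q) < 1 / 2 →
      ∀ w ∈ W₀, w * q ∈ (U : Set G) := by
    intro U p q hp hpq w hw
    refine hu0 U _ fun h0 => ?_
    have h1 := dist_triangle (u U p) (u U q) (u U (w * q))
    rw [h0, hp] at h1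
    have h2 := hW₀u w hw q U
    rw [h0] at h2
    rw [hp] at hpq
    have h3 : dist (1 : unitInterval) 0 = 1 := by simp [Subtype.dist_eq]
    linarith
  -- Closeness of `v p` and `v q` controls `k⁻¹ * p` and `k⁻¹ * q` for all `k ∈ E` at once, as the
  -- join requires.
  let v : G → (𝒰 × E → unitInterval) := fun x i => u i.1 ((i.2 : G)⁻¹ * x)
  have hv : UniformContinuous v := uniformContinuous_pi.2 fun i =>
    (hu i.1).comp (uniformContinuous_leftTranslation_right _)
  have hε' : 0 < ε / (2 * (E.card + 1)) := by positivity
  -- With `n ≥ L`, the constant `𝒰.ncard ^ E.card` is absorbed in `ε / 2 * n`; the labels of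
  -- exceptions take the other half.
  obtain ⟨L, hL⟩ := exists_nat_ge ((𝒰.ncard : ℝ) ^ E.card / (ε / 2))
  obtain ⟨n, d, x₀, hn, hd, hx₀⟩ := hG.exists_isAlmostPermuted hv E
    (show (0 : ℝ) < 1 / 8 by norm_num) hε' L
  choose φ hφ hφd using hx₀
  obtain ⟨x, hxO, hx⟩ := exists_perturbation hdisc (insert 1 E) (x := x₀)
    (O := fun i => {y | ∀ g : E, dist (v (g * y)) (v (g * x₀ i)) < 1 / 8}) fun i => by
      refine eventually_all.2 fun g => ?_
      have hc : Continuous fun y => v (g * y) :=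
        hv.continuous.comp (continuous_const_mul (g : G))
      exact hc.continuousAt.eventually (Metric.ball_mem_nhds _ (by norm_num))
  -- A matched translate is labelled by its partner, an exception by a label that no other translate
  -- has. Two matchings and two perturbations, each within `1 / 8`, keep equal labels within `1 /
  -- 2`.
  let lab : E → Fin n → Fin n ⊕ (E × Fin d) := fun g j => Sum.map id (Prod.mk g) (φ g g.2 j)
  have hlab : ∀ g, Function.Injective (lab g) := fun g =>
    (Sum.map_injective.2 ⟨Function.injective_id, Prod.mk_right_injective g⟩).comp (hφ g g.2)
  have hclose : ∀ (g h : E) i j, lab h j = lab g i → dist (v (h * x j)) (v (g * x i)) < 1 / 2 := by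
    intro g h i j hl
    rcases hi : φ g g.2 i with y | t <;> rcases hj : φ h h.2 j with y' | t'
    · obtain rfl : y' = y := by simpa [lab, hi, hj] using hl
      have h1 := hφd g g.2 i y' hi
      have h2 := hφd h h.2 j y' hj
      have h3 := hxO i g
      have h4 := hxO j h
      have h5 := dist_triangle4 (v (h * x j)) (v (h * x₀ j)) (v (g * x₀ i)) (v (g * x i))
      have h6 := dist_triangle_right (v (h * x₀ j)) (v (g * x₀ i)) (v (x₀ y'))
      rw [dist_comm (v (g * x₀ i))] at h5
      linarith
    · simp [lab, hi, hj] at hl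
    · simp [lab, hi, hj] at hl
    · obtain ⟨rfl, rfl⟩ : h = g ∧ t' = t := by simpa [lab, hi, hj] using hl
      obtain rfl := hφ h h.2 (hi.trans hj.symm)
      simp
  have hcoord : ∀ (k : E) U p q, dist (v p) (v q) < 1 / 2 →
      dist (u U ((k : G)⁻¹ * p)) (u U ((k : G)⁻¹ * q)) < 1 / 2 := fun k U p q h =>
    (dist_le_pi_dist (v p) (v q) (U, k)).trans_lt h
  obtain ⟨𝒱, h𝒱, href, hlow, hup⟩ := exists_cover_of_labelling h𝒰.1 hW₀
    (fun z => let ⟨U, hU⟩ := hu1 z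
      ⟨U, U.2, hmem U z z hU (by simp)⟩) E x
    (fun i j hij => hx 1 (by simp) 1 (by simp) i j (by rw [hij]))
    (fun g hg h hh => hx g (by simp [hg]) h (by simp [hh])) lab hlab
    (fun j => by
      obtain ⟨U, hU⟩ := hu1 (x j)
      refine ⟨U, U.2, fun w hw => ⟨hmem U _ _ hU (by simp) w hw, fun g h j' hl => ?_⟩⟩
      refine hmem U _ _ hU ?_ w hw
      simpa using hcoord h U _ _ (hclose g h j' j hl))
    (fun g l => by
      by_cases hex : ∃ (h : E) (j : Fin n), lab h j = l
      · obtain ⟨h, j, rfl⟩ := hex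
        obtain ⟨U, hU⟩ := hu1 ((g : G)⁻¹ * (h * x j))
        exact ⟨U, U.2, fun h' j' hl w hw => hmem U _ _ hU
          (hcoord g U _ _ (hclose h' h j' j hl.symm)) w hw⟩
      · push Not at hex
        obtain ⟨U, -⟩ := hu1 1
        exact ⟨U, U.2, fun h j hl => (hex h j hl).elim⟩)
  refine ⟨𝒱, h𝒱, href, ?_⟩
  have hup' : (rightUniformComplexity (translateJoin E 𝒱) : ℝ) ≤
      n + E.card * d + (𝒰.ncard : ℝ) ^ E.card := by
    have := hup
    simp only [Fintype.card_sum, Fintype.card_prod, Fintype.card_fin, Fintype.card_coe] at this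
    exact_mod_cast this
  have hE : (E.card : ℝ) * d ≤ ε / 2 * n := by
    calc (E.card : ℝ) * d ≤ (E.card + 1) * (ε / (2 * (E.card + 1)) * n) := by gcongr; linarith
      _ = ε / 2 * n := by field_simp
  have hLn : (𝒰.ncard : ℝ) ^ E.card ≤ ε / 2 * n := by
    rw [div_le_iff₀ (by positivity)] at hL
    refine hL.trans ?_
    rw [mul_comm]
    gcongr
  have hnN : (n : ℝ) ≤ rightUniformComplexity 𝒱 := Nat.cast_le.2 hlow
  calc _ ≤ (1 + ε) * (n : ℝ) := by linarith
    _ ≤ _ := by gcongr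

theorem isAmenableTopologicalGroup_of_exists_complexity_le
    (h : ∀ (E : Finset G), ∀ 𝒰 ∈ rightFiniteUniformCovers G, ∀ ε : ℝ, 0 < ε →
      ∃ 𝒱 ∈ rightFiniteUniformCovers G, UniformCover.Refines 𝒱 𝒰 ∧
        (rightUniformComplexity (translateJoin E 𝒱) : ℝ) ≤ (1 + ε) * rightUniformComplexity 𝒱) :
    IsAmenableTopologicalGroup G := by
  classical
  let : UniformSpace G := IsTopologicalGroup.rightUniformSpace G
  refine isAmenableTopologicalGroup_of_isAlmostPermuted fun K _ _ u hu E ε hε => ?_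
  obtain ⟨𝒰, h𝒰, hdiam⟩ := UniformCover.exists_finiteUniformCovers_dist_lt hu (half_pos hε)
  -- The element 1 controls the members themselves, and `g⁻¹` controls their translates by `g`.
  obtain ⟨𝒱, h𝒱, href, hle⟩ := h (insert 1 (E.image (·⁻¹))) 𝒰 h𝒰 ε hε
  obtain ⟨n, hn, hnle, x, hx⟩ := exists_isAlmostPermuted_of_complexity E h𝒱
    (fun V hV y hy z hz => by
      obtain ⟨U, hU, hVU⟩ := href V hV
      exact hdiam U hU y (hVU hy) z (hVU hz))
    (F := insert 1 (E.image (·⁻¹))) (by simp) (fun g hg => by simp [hg])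
  refine ⟨n, _, x, hn, ?_, by simpa using hx⟩
  rcases le_total n (rightUniformComplexity 𝒱) with hN | hN
  · rw [Nat.sub_eq_zero_of_le hN, Nat.cast_zero]; positivity
  · rw [Nat.cast_sub hN]
    have h1 : (n : ℝ) ≤ rightUniformComplexity (translateJoin _ 𝒱) := Nat.cast_le.2 hnle
    have h2 : ε * (rightUniformComplexity 𝒱 : ℝ) ≤ ε * n := by gcongr
    linarith

theorem rightUniformComplexity_translateJoin_one (𝒱 : Set (Set G)) :
    rightUniformComplexity (translateJoin {1} 𝒱) = rightUniformComplexity 𝒱 := by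
  congr 1
  ext S
  rw [mem_translateJoin]
  constructor
  · rintro ⟨V, hV, rfl⟩
    convert hV ⟨1, by simp⟩
    ext x
    constructor
    · intro h
      simpa using h ⟨1, by simp⟩
    · rintro h ⟨g, hg⟩
      obtain rfl := Finset.mem_singleton.1 hg
      simpa using h
  · intro hS
    refine ⟨fun _ => S, fun _ => hS, ?_⟩
    ext x
    simp

end main

theorem corollary7p3 {G : Type*} [Group G] [TopologicalSpace G] [IsTopologicalGroup G]
    [T2Space G] (hG : ¬ DiscreteTopology G) :
    IsAmenableTopologicalGroup G ↔
      (⨆ E : Finset G, ⨆ 𝒰 ∈ rightFiniteUniformCovers G,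
        ⨅ 𝒱 ∈ {𝒱 | 𝒱 ∈ rightFiniteUniformCovers G ∧ UniformCover.Refines 𝒱 𝒰},
          (rightUniformComplexity (translateJoin E 𝒱) : ℝ≥0∞) /
            (rightUniformComplexity 𝒱 : ℝ≥0∞)) = 1 := by
  have hpos : ∀ 𝒱 ∈ rightFiniteUniformCovers G, (rightUniformComplexity 𝒱 : ℝ≥0∞) ≠ 0 :=
    fun 𝒱 h𝒱 => Nat.cast_ne_zero.2 (rightUniformComplexity_pos h𝒱).ne'
  have hiff : ∀ 𝒱 ∈ rightFiniteUniformCovers G, ∀ (E : Finset G) (ε : ℝ), 0 < ε →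
      ((rightUniformComplexity (translateJoin E 𝒱) : ℝ≥0∞) / rightUniformComplexity 𝒱 ≤
        1 + ENNReal.ofReal ε ↔
      (rightUniformComplexity (translateJoin E 𝒱) : ℝ) ≤ (1 + ε) * rightUniformComplexity 𝒱) := by
    intro 𝒱 h𝒱 E ε hε
    rw [ENNReal.div_le_iff (hpos 𝒱 h𝒱) (ENNReal.natCast_ne_top _), ← ENNReal.ofReal_one,
      ← ENNReal.ofReal_add zero_le_one hε.le, ← ENNReal.ofReal_natCast, ← ENNReal.ofReal_natCast,
      ← ENNReal.ofReal_mul (by positivity), ENNReal.ofReal_le_ofReal_iff (by positivity)]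
  constructor
  · intro h
    refine le_antisymm (iSup_le fun E => iSup₂_le fun 𝒰 h𝒰 => ?_) ?_
    · refine ENNReal.le_of_forall_pos_le_add fun ε hε _ => ?_
      obtain ⟨𝒱, h𝒱, href, hle⟩ := h.exists_complexity_le hG E h𝒰 (ε := ε) hε
      refine (iInf₂_le 𝒱 ⟨h𝒱, href⟩).trans ?_
      simpa using (hiff 𝒱 h𝒱 E ε hε).2 hle
    -- The supremum is at least 1 already for the trivial join, whose ratio is exactly 1.
    · refine le_iSup_of_le {1} (le_iSup₂_of_le {univ} ?_ (le_iInf₂ fun 𝒱 h𝒱 => ?_))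
      · exact mem_rightFiniteUniformCovers_iff.2 ⟨finite_singleton _, univ, univ_mem, by simp⟩
      · rw [rightUniformComplexity_translateJoin_one,
          ENNReal.div_self (hpos 𝒱 h𝒱.1) (ENNReal.natCast_ne_top _)]
  · intro h
    refine isAmenableTopologicalGroup_of_exists_complexity_le fun E 𝒰 h𝒰 ε hε => ?_
    have hlt : (⨅ 𝒱 ∈ {𝒱 | 𝒱 ∈ rightFiniteUniformCovers G ∧ UniformCover.Refines 𝒱 𝒰},
        (rightUniformComplexity (translateJoin E 𝒱) : ℝ≥0∞) /
          (rightUniformComplexity 𝒱 : ℝ≥0∞)) < 1 + ENNReal.ofReal ε := by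
      refine (iSup₂_le_iff.1 (iSup_le_iff.1 h.le E) 𝒰 h𝒰).trans_lt ?_
      exact ENNReal.lt_add_right ENNReal.one_ne_top (by simpa using hε)
    obtain ⟨𝒱, hlt⟩ := iInf_lt_iff.1 hlt
    obtain ⟨⟨h𝒱, href⟩, hlt⟩ := iInf_lt_iff.1 hlt
    exact ⟨𝒱, h𝒱, href, (hiff 𝒱 h𝒱 E ε hε).1 hlt.le⟩
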